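/- Let $d\ge 1$ and let $Y=\{Y_t:t\in\mathbb{R}^d\}$ be a centered Gaussian random field with stationary increments (the law of $\{Y_{t+h}-Y_h\}_{t}$ does not depend on $h\in\mathbb{R}^d$) and variance $\sigma^2(t)=\operatorname{Var}Y_t$. Let $Y^{(j)}$, $j\in\mathbb{N}$, be independent copies of $Y$, and let $\{\xi_j\}_{j\in\mathbb{N}}$ be the points of a Poisson process on $\mathbb{R}$ with intensity measure $e^{-x}\,dx$, the sequence $(\xi_j)_j$ being independent of $(Y^{(j)})_j$. The Brown–Resnick field is $$R_t=\max_{j\in\mathbb{N}}\{\xi_j+Y^{(j)}_t-\sigma^2(t)/2\},\qquad B_t=e^{R_t},\qquad t\in\mathbb{R}^d,$$ where for each $t$ the maximum is almost surely attained. For $t_1,\dots,t_n\in\mathbb{R}^d$ let $\mathbf{B}_T=(B_{t_1},\dots,B_{t_n})$, let $$l_{\mathbf{B}_T}(\mathbf{x})=-\log \mathbb{P}\left(B_{t_1}\le x_1^{-1},\dots,B_{t_n}\le x_n^{-1}\right),\qquad \mathbf{x}\in[0,\infty)^n\quad (0^{-1}:=+\infty),$$ be its tail dependence function, let $\Sigma_n$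 be the covariance matrix of $(Y_{t_1},\dots,Y_{t_n})$, and let $F_{\Sigma_n}$ be the distribution function of $N(\mathbf{0},\Sigma_n)$ (with arguments $+\infty$ allowed). Then for all $\mathbf{x}=(x_1,\dots,x_n)\in[0,\infty)^n$ $$l_{\mathbf{B}_T}(\mathbf{x})=\int_{\mathbb{R}^n}\max_{1\le j\le n} x_j e^{z_j-\frac12\sigma^2(t_j)}\,N(\mathbf{0},\Sigma_n)(d\mathbf{z}) =\int_0^\infty\left[1-F_{\Sigma_n}\left(\log\frac{y}{x_1}+\frac{\sigma^2(t_1)}{2},\dots,\log\frac{y}{x_n}+\frac{\sigma^2(t_n)}{2}\right)\right]dy,$$ where $\log(y/0):=+\infty$ and both integrands are integrable. If $\Sigma_n$ is positive definite, then with $f_{\Sigma_n}(\mathbf{z})=(2\pi)^{-n/2}(\det\Sigma_n)^{-1/2}\exp\left(-\frac12\mathbf{z}^\top\Sigma_n^{-1}\mathbf{z}\right)$ the first integral is $$l_{\mathbf{B}_T}(\mathbf{x})=\int_{\mathbb{R}^n}\max_{1\le j\le n} x_j e^{z_j-\frac12\sigma^2(t_j)}f_{\Sigma_n}(\mathbf{z})\,d\mathbf{z},$$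 its integrand being integrable as well. -/

import Mathlib

open MeasureTheory ProbabilityTheory
open scoped ENNReal NNReal

noncomputable section

namespace BrownResnick

/-- The point process `∑ⱼ δ_{ξⱼ}` of a sequence of random points `ξⱼ`, as a random measure. -/
def pointProcess {Ω : Type*} (ξ : ℕ → Ω → ℝ) (ω : Ω) : Measure ℝ :=
  Measure.sum fun j => Measure.dirac (ξ j ω)

/-- The random variables `ξ₀, ξ₁, …` are the points of a Poisson process on `ℝ` with intensity
measure `μ`: the number of points in a measurable set of finite intensity is Poisson distributed
with parameter `μ A`, and the numbers of points in disjoint measurable sets are independent. -/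
structure IsPoissonProcess {Ω : Type*} [MeasurableSpace Ω] (ξ : ℕ → Ω → ℝ) (μ : Measure ℝ)
    (P : Measure Ω) : Prop where
  measurable : ∀ j, Measurable (ξ j)
  hasLaw : ∀ A : Set ℝ, MeasurableSet A → μ A < ∞ →
    HasLaw (fun ω => pointProcess ξ ω A)
      ((poissonMeasure (μ A).toNNReal).map (fun k : ℕ => (k : ℝ≥0∞))) P
  indep : ∀ (k : ℕ) (A : Fin k → Set ℝ), (∀ i, MeasurableSet (A i)) →
    Pairwise (Function.onFun Disjoint A) →
    iIndepFun (fun i ω => pointProcess ξ ω (A i)) P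

/-- The measure `e^{-x} dx` on `ℝ`. -/
def expIntensity : Measure ℝ :=
  volume.withDensity fun x => ENNReal.ofReal (Real.exp (-x))

/-- `Y` is a centered Gaussian random field. -/
structure IsCenteredGaussianField {T Ω : Type*} [MeasurableSpace Ω] (Y : T → Ω → ℝ)
    (P : Measure Ω) : Prop where
  measurable : ∀ t, Measurable (Y t)
  isGaussian : IsGaussianProcess Y P
  centered : ∀ t, ∫ ω, Y t ω ∂P = 0

/-- The law of the field `(Y_{t+h} - Y_h)_t` does not depend on `h`. -/
def HasStationaryIncrements {T Ω : Type*} [AddGroup T] [MeasurableSpace Ω] (Y : T → Ω → ℝ)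
    (P : Measure Ω) : Prop :=
  ∀ h : T, IdentDistrib (fun ω t => Y (t + h) ω - Y h ω) (fun ω t => Y t ω - Y 0 ω) P P

/-- The Brown–Resnick field `R_t = max_j (ξⱼ + Y^{(j)}_t - σ²(t)/2)` with Gumbel margins; `v` is
the variance function `σ²`. -/
def gumbelField {T Ω : Type*} (ξ : ℕ → Ω → ℝ) (Y : ℕ → T → Ω → ℝ) (v : T → ℝ) (t : T) (ω : Ω) :
    ℝ :=
  ⨆ j, (ξ j ω + Y j t ω - v t / 2)

/-- The Brown–Resnick field `B_t = e^{R_t}` with unit Fréchet margins. -/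
def frechetField {T Ω : Type*} (ξ : ℕ → Ω → ℝ) (Y : ℕ → T → Ω → ℝ) (v : T → ℝ) (t : T) (ω : Ω) :
    ℝ :=
  Real.exp (gumbelField ξ Y v t ω)

/-- The joint distribution function `P(X₁ ≤ a₁, …, Xₙ ≤ aₙ)`; the arguments may be infinite. -/
def jointCDF {Ω : Type*} [MeasurableSpace Ω] {n : ℕ} (X : Fin n → Ω → ℝ) (P : Measure Ω)
    (a : Fin n → EReal) : ℝ :=
  P.real {ω | ∀ i, (X i ω : EReal) ≤ a i}

/-- The tail dependence function `l_X(y) = -log G(y^{-1/α})` for `y ∈ [0,∞)ⁿ`, where `G` is the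
distribution function of `X` (whose margins are `α`-Fréchet). Here `0^{-1/α} = ∞`. -/
def tailDependence {Ω : Type*} [MeasurableSpace Ω] {n : ℕ} (α : ℝ) (X : Fin n → Ω → ℝ)
    (P : Measure Ω) (y : Fin n → ℝ) : ℝ :=
  -Real.log (jointCDF X P fun i => (((ENNReal.ofReal (y i) ^ (1 / α))⁻¹ : ℝ≥0∞) : EReal))

/-- The distribution function `F_S` of `N(0, S)`. -/
def gaussianCDF {n : ℕ} (S : Matrix (Fin n) (Fin n) ℝ) (a : Fin n → EReal) : ℝ :=
  jointCDF (fun i (z : EuclideanSpace ℝ (Fin n)) => z i) (multivariateGaussian 0 S) a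

/-- The Lebesgue density `f_S` of `N(0, S)` for positive definite `S`. -/
def gaussianDensity {n : ℕ} (S : Matrix (Fin n) (Fin n) ℝ) (z : Fin n → ℝ) : ℝ :=
  (2 * Real.pi) ^ (-(n : ℝ) / 2) * S.det ^ (-(1 / 2) : ℝ) *
    Real.exp (-(1 / 2) * (z ⬝ᵥ S⁻¹.mulVec z))

/-- The covariance matrix of `(Y_{t₁}, …, Y_{tₙ})`. -/
def covMatrix {T Ω : Type*} [MeasurableSpace Ω] {n : ℕ} (Y : T → Ω → ℝ) (P : Measure Ω)
    (t : Fin n → T) : Matrix (Fin n) (Fin n) ℝ :=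
  Matrix.of fun i j => cov[Y (t i), Y (t j); P]

end BrownResnick

end

/-!
The joint distribution function of the field `B` at the points `1 / xᵢ` is a void probability.
Put `W_j = maxᵢ xᵢ exp (Y^{(j)}_{tᵢ} - σ²(tᵢ) / 2)`. Since the maximum defining the field is almost
surely attained, all `xᵢ B_{tᵢ}` are at most `1` exactly when no marked point `(ξ_j, W_j)` falls
into `C = {(u, w) | 1 < eᵘ w}`.

The marks are independent, with the common law `ν` of `maxᵢ xᵢ exp (zᵢ - σ²(tᵢ) / 2)` under
`N(0, S)`, and they are independent of the points. Given the points, the void probability is the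
product of the numbers `1 - ν C_{ξ_j}`, with `C_u` the section of `C` at `u`. Its mean is a value of
the Laplace functional of a Poisson process (`IsPoissonProcess.laplace`), whence the void
probability is `exp (-(μ ⊗ ν) C)` for the intensity `μ` of the points
(`IsPoissonProcess.measure_forall_marked_notMem`). For `μ = e^{-u} du` Fubini's theorem gives
`(μ ⊗ ν) C = ∫ w ν(dw)` (`expIntensity_prod_one_lt`), which is the first formula
(`tailDependence_frechetField`).

The integral is finite because Gaussian laws have exponential moments. As the expected number of
marked points in a set is at most its intensity, this finiteness, applied to a single site and to
all rescaled levels, also shows through the Borel–Cantelli lemma that above every level there are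
only finitely many of the values `ξ_j + Y^{(j)}_s - σ²(s) / 2`, so that their maximum is attained
(`ae_isGreatest_gumbelField`). The second formula is the layer cake formula for the first integral,
and the formula with the density is a linear change of variables by the square root of `S`.
-/

open Filter Topology

noncomputable section

namespace BrownResnick

/-! ### The Laplace functional of a Poisson process -/

section

/-- The function `a ↦ e^{-a}` on `[0,∞]`, with `e^{-∞} = 0`. -/
def expNeg (a : ℝ≥0∞) : ℝ≥0∞ := EReal.exp (-(a : EReal))

lemma expNeg_eq_inv (a : ℝ≥0∞) : expNeg a = (EReal.exp a)⁻¹ := EReal.exp_neg _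

@[simp] lemma expNeg_zero : expNeg 0 = 1 := by simp [expNeg]

lemma expNeg_le_one (a : ℝ≥0∞) : expNeg a ≤ 1 := by
  simp [expNeg, EReal.coe_ennreal_nonneg]

lemma expNeg_add (a b : ℝ≥0∞) : expNeg (a + b) = expNeg a * expNeg b := by
  have h (c : ℝ≥0∞) : EReal.exp c ≠ 0 := by
    simp
  rw [expNeg_eq_inv, expNeg_eq_inv, expNeg_eq_inv, EReal.coe_ennreal_add, EReal.exp_add,
    ENNReal.mul_inv (Or.inl (h a)) (Or.inr (h b))]

lemma expNeg_sum {ι : Type*} (s : Finset ι) (f : ι → ℝ≥0∞) :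
    expNeg (∑ i ∈ s, f i) = ∏ i ∈ s, expNeg (f i) := by
  classical
  induction s using Finset.induction_on with
  | empty => simp
  | insert a s ha ih => rw [Finset.sum_insert ha, Finset.prod_insert ha, expNeg_add, ih]

lemma expNeg_mul_natCast (a : ℝ≥0∞) (n : ℕ) : expNeg (a * n) = expNeg a ^ n := by
  simpa [mul_comm] using expNeg_sum (Finset.range n) fun _ => a

lemma continuous_expNeg : Continuous expNeg := by
  unfold expNeg
  exact ENNReal.continuous_exp.comp (continuous_neg.comp continuous_coe_ennreal_ereal)

@[fun_prop]
lemma measurable_expNeg : Measurable expNeg := continuous_expNeg.measurable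

lemma expNeg_anti : Antitone expNeg := fun a b h => by
  simpa [expNeg] using h

lemma expNeg_tsum {ι : Type*} (f : ι → ℝ≥0∞) : expNeg (∑' i, f i) = ∏' i, expNeg (f i) := by
  have h : HasProd (fun i => expNeg (f i)) (expNeg (∑' i, f i)) := by
    have := (continuous_expNeg.tendsto _).comp (ENNReal.summable (f := f)).hasSum
    refine this.congr fun s => ?_
    simp [expNeg_sum]
  exact h.tprod_eq.symm

lemma expNeg_ofReal {a : ℝ} (ha : 0 ≤ a) :
    expNeg (ENNReal.ofReal a) = ENNReal.ofReal (Real.exp (-a)) := by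
  rw [expNeg, EReal.coe_ennreal_ofReal, max_eq_left ha, ← EReal.coe_neg, EReal.exp_coe]

/-- Every number in `[0, 1]` is of the form `e^{-a}`, `a ∈ [0, ∞]`. -/
lemma expNeg_toENNReal_neg_log {p : ℝ≥0∞} (hp : p ≤ 1) :
    expNeg (-ENNReal.log p).toENNReal = p := by
  have h : 0 ≤ -ENNReal.log p := by
    rw [EReal.le_neg]; simpa using hp
  rw [expNeg, EReal.coe_toENNReal h, neg_neg, ENNReal.exp_log]

lemma ofReal_one_sub_toReal {p : ℝ≥0∞} (hp : p ≤ 1) :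
    ENNReal.ofReal (1 - p.toReal) = 1 - p := by
  have hp' : p ≠ ⊤ := ne_top_of_le_ne_top ENNReal.one_ne_top hp
  rw [ENNReal.ofReal_sub _ ENNReal.toReal_nonneg, ENNReal.ofReal_toReal hp', ENNReal.ofReal_one]

/-- The Laplace transform of a Poisson variable. -/
lemma lintegral_expNeg_poissonMeasure (r : ℝ≥0) (c : ℝ≥0∞) :
    ∫⁻ k : ℕ, expNeg (c * k) ∂(poissonMeasure r) = expNeg (r * (1 - expNeg c)) := by
  have hc := expNeg_le_one c
  have hc' : expNeg c ≠ ⊤ := ne_top_of_le_ne_top ENNReal.one_ne_top hc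
  set q : ℝ := (expNeg c).toReal with hq
  have hq0 : 0 ≤ q := ENNReal.toReal_nonneg
  have hq1 : q ≤ 1 := by
    simpa using ENNReal.toReal_mono ENNReal.one_ne_top hc
  have hcq : expNeg c = ENNReal.ofReal q := (ENNReal.ofReal_toReal hc').symm
  have hsum : HasSum (fun n : ℕ => Real.exp (-r) * r ^ n / n.factorial * q ^ n)
      (Real.exp (-(r * (1 - q)))) := by
    have h := (NormedSpace.expSeries_div_hasSum_exp (r * q : ℝ)).mul_left (Real.exp (-r))
    rw [← Real.exp_eq_exp_ℝ, ← Real.exp_add] at h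
    rw [show -((r : ℝ) * (1 - q)) = -r + r * q by ring]
    refine h.congr_fun fun n => ?_
    rw [mul_pow]
    ring
  rw [poissonMeasure, lintegral_sum_measure]
  simp only [lintegral_smul_measure, lintegral_dirac, expNeg_mul_natCast]
  have h1 : expNeg (r * (1 - expNeg c)) = ENNReal.ofReal (Real.exp (-(r * (1 - q)))) := by
    rw [← ofReal_one_sub_toReal hc, ← ENNReal.ofReal_coe_nnreal, ← ENNReal.ofReal_mul r.coe_nonneg,
      expNeg_ofReal (mul_nonneg r.coe_nonneg (by linarith))]
  rw [h1, ← hsum.tsum_eq, ENNReal.ofReal_tsum_of_nonneg (fun n => by positivity) hsum.summable]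
  refine tsum_congr fun n => ?_
  rw [hcq, ← ENNReal.ofReal_pow hq0, smul_eq_mul, ← ENNReal.ofReal_mul (by positivity)]

lemma lintegral_pointProcess {Ω : Type*} {ξ : ℕ → Ω → ℝ} (ω : Ω) {f : ℝ → ℝ≥0∞}
    (hf : Measurable f) :
    ∫⁻ u, f u ∂(pointProcess ξ ω) = ∑' j, f (ξ j ω) := by
  simp [pointProcess, lintegral_sum_measure, lintegral_dirac' _ hf]

variable {Ω : Type*} [MeasurableSpace Ω] {P : Measure Ω} {ξ : ℕ → Ω → ℝ} {μ : Measure ℝ}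

lemma measurable_pointProcess_apply (hξ : ∀ j, Measurable (ξ j)) {A : Set ℝ}
    (hA : MeasurableSet A) : Measurable fun ω => pointProcess ξ ω A := by
  have h (ω : Ω) : pointProcess ξ ω A = ∑' j, A.indicator 1 (ξ j ω) := by
    simp [pointProcess, hA]
  simp_rw [h]
  exact Measurable.tsum fun j =>
    (measurable_one.indicator hA).comp (hξ j)

/-- The Laplace functional of a Poisson process at a simple function whose support has finite
intensity. -/
lemma IsPoissonProcess.laplace_simpleFunc (hξ : IsPoissonProcess ξ μ P) (g : SimpleFunc ℝ ℝ≥0∞)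
    (hg : ∀ c, c ≠ 0 → μ (g ⁻¹' {c}) < ∞) :
    ∫⁻ ω, expNeg (∫⁻ u, g u ∂(pointProcess ξ ω)) ∂P = expNeg (∫⁻ u, (1 - expNeg (g u)) ∂μ) := by
  classical
  set A : g.range → Set ℝ := fun c => g ⁻¹' {(c : ℝ≥0∞)} with hA
  have hAm (c) : MeasurableSet (A c) := g.measurableSet_preimage _
  have hdisj : Pairwise (Function.onFun Disjoint A) := by
    intro a b hab
    exact (Set.disjoint_singleton.2 fun h => hab (Subtype.ext h)).preimage g
  set e := Fintype.equivFin g.range with he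
  have hind : iIndepFun (fun (c : g.range) ω => pointProcess ξ ω (A c)) P := by
    have h := hξ.indep _ (fun i => A (e.symm i)) (fun i => hAm _)
      (fun i j hij => hdisj (e.symm.injective.ne hij))
    have h2 := h.precomp e.injective
    refine (iIndepFun_congr fun c => ?_).1 h2
    simp
  have hind' : iIndepFun (fun (c : g.range) ω => expNeg (c * pointProcess ξ ω (A c))) P :=
    hind.comp (fun c x => expNeg (c * x)) (fun c => by fun_prop)
  have hl (ω : Ω) : expNeg (∫⁻ u, g u ∂(pointProcess ξ ω)) =
      ∏ c : g.range, expNeg (c * pointProcess ξ ω (A c)) := by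
    rw [← expNeg_sum, SimpleFunc.lintegral_eq_lintegral, SimpleFunc.lintegral,
      ← Finset.sum_coe_sort g.range]
  have hr : ∫⁻ u, (1 - expNeg (g u)) ∂μ = ∑ c : g.range, (1 - expNeg c) * μ (A c) := by
    have : (fun u => 1 - expNeg (g u)) = g.map (fun c => 1 - expNeg c) := by
      ext u; simp
    rw [this, SimpleFunc.lintegral_eq_lintegral, SimpleFunc.map_lintegral,
      ← Finset.sum_coe_sort g.range]
  simp_rw [hl]
  rw [lintegral_prod_eq_prod_lintegral_of_indepFun _ _ hind' fun c => by
    have := measurable_pointProcess_apply hξ.measurable (hAm c)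
    fun_prop]
  rw [hr, expNeg_sum]
  refine Finset.prod_congr rfl fun c _ => ?_
  have hP : IsProbabilityMeasure P := hind.isProbabilityMeasure
  -- The level set of the value `0` may have infinite intensity, but it contributes the factor `1`.
  by_cases hc : (c : ℝ≥0∞) = 0
  · simp [hc]
  have hfin := hg c hc
  have hlaw := hξ.hasLaw (A c) (hAm c) hfin
  have hm : Measurable fun x : ℝ≥0∞ => expNeg (c * x) := by fun_prop
  have h1 := hlaw.lintegral_comp hm.aemeasurable
  rw [h1, lintegral_map hm (by fun_prop), lintegral_expNeg_poissonMeasure,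
    ENNReal.coe_toNNReal hfin.ne, mul_comm]

/-- The Laplace functional of a Poisson process `N` with intensity `μ`:
`E exp (-∫ f dN) = exp (-∫ (1 - e^{-f}) dμ)`. -/
theorem IsPoissonProcess.laplace [IsProbabilityMeasure P] [SigmaFinite μ]
    (hξ : IsPoissonProcess ξ μ P) {f : ℝ → ℝ≥0∞} (hf : Measurable f) :
    ∫⁻ ω, expNeg (∫⁻ u, f u ∂(pointProcess ξ ω)) ∂P = expNeg (∫⁻ u, (1 - expNeg (f u)) ∂μ) := by
  -- The counts are Poisson distributed only on sets of finite intensity, so `f` is approximated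
  -- from below by simple functions that vanish outside an exhausting sequence of such sets.
  set g : ℕ → SimpleFunc ℝ ℝ≥0∞ := fun n => (SimpleFunc.eapprox f n).restrict (spanningSets μ n)
    with hgdef
  have hS (n) : MeasurableSet (spanningSets μ n) := measurableSet_spanningSets μ n
  have hgmono : Monotone g := by
    intro m n hmn u
    simp only [hgdef, SimpleFunc.restrict_apply _ (hS _)]
    exact (Set.indicator_le_indicator_of_subset (monotone_spanningSets μ hmn)
      (fun _ => zero_le) u).trans
        (Set.indicator_le_indicator (SimpleFunc.monotone_eapprox f hmn u))
  have hglim (u : ℝ) : Tendsto (fun n => g n u) atTop (𝓝 (f u)) := by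
    refine (SimpleFunc.tendsto_eapprox hf u).congr' ?_
    filter_upwards [eventually_ge_atTop (spanningSetsIndex μ u)] with n hn
    simp [hgdef, SimpleFunc.restrict_apply _ (hS _),
      Set.indicator_of_mem (mem_spanningSets_of_index_le μ u hn)]
  have hgfin (n : ℕ) (c : ℝ≥0∞) (hc : c ≠ 0) : μ (g n ⁻¹' {c}) < ∞ := by
    rw [hgdef, SimpleFunc.restrict_preimage_singleton _ (hS n) hc]
    exact (measure_mono Set.inter_subset_left).trans_lt (measure_spanningSets_lt_top μ n)
  have key (n : ℕ) := hξ.laplace_simpleFunc (g n) (hgfin n)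
  have hN (ω : Ω) : Tendsto (fun n => ∫⁻ u, g n u ∂(pointProcess ξ ω)) atTop
      (𝓝 (∫⁻ u, f u ∂(pointProcess ξ ω))) :=
    lintegral_tendsto_of_tendsto_of_monotone (fun n => (g n).measurable.aemeasurable)
      (ae_of_all _ fun u m n h => hgmono h u) (ae_of_all _ hglim)
  have hmeas (n : ℕ) : Measurable fun ω => ∫⁻ u, g n u ∂(pointProcess ξ ω) := by
    simp_rw [lintegral_pointProcess _ (g n).measurable]
    exact Measurable.tsum fun j => (g n).measurable.comp (hξ.measurable j)
  have hleft : Tendsto (fun n => ∫⁻ ω, expNeg (∫⁻ u, g n u ∂(pointProcess ξ ω)) ∂P) atTop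
      (𝓝 (∫⁻ ω, expNeg (∫⁻ u, f u ∂(pointProcess ξ ω)) ∂P)) := by
    refine tendsto_lintegral_of_dominated_convergence (fun _ => 1)
      (fun n => measurable_expNeg.comp (hmeas n))
      (fun n => ae_of_all _ fun ω => expNeg_le_one _) (by simp) (ae_of_all _ fun ω => ?_)
    exact (continuous_expNeg.tendsto _).comp (hN ω)
  have hright : Tendsto (fun n => expNeg (∫⁻ u, (1 - expNeg (g n u)) ∂μ)) atTop
      (𝓝 (expNeg (∫⁻ u, (1 - expNeg (f u)) ∂μ))) := by
    refine (continuous_expNeg.tendsto _).comp ?_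
    refine lintegral_tendsto_of_tendsto_of_monotone
      (fun n => (measurable_const.sub (measurable_expNeg.comp (g n).measurable)).aemeasurable)
      (ae_of_all _ fun u m n h => tsub_le_tsub_left (expNeg_anti (hgmono h u)) _)
      (ae_of_all _ fun u => ?_)
    exact ENNReal.Tendsto.sub tendsto_const_nhds ((continuous_expNeg.tendsto _).comp (hglim u))
      (Or.inl ENNReal.one_ne_top)
  exact tendsto_nhds_unique (hleft.congr key) hright

end

/-! ### Poisson processes with independent marks -/

section

lemma lintegral_natCast_poissonMeasure (r : ℝ≥0) :
    ∫⁻ k : ℕ, (k : ℝ≥0∞) ∂(poissonMeasure r) = r := by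
  have h0 (n : ℕ) : ENNReal.ofReal (Real.exp (-r) * r ^ (n + 1) / (n + 1).factorial) *
      ((n + 1 : ℕ) : ℝ≥0∞) = r * ENNReal.ofReal (Real.exp (-r) * r ^ n / n.factorial) := by
    rw [← ENNReal.ofReal_natCast (n + 1), ← ENNReal.ofReal_mul (by positivity),
      ← ENNReal.ofReal_coe_nnreal, ← ENNReal.ofReal_mul r.coe_nonneg]
    congr 1
    rw [Nat.factorial_succ]
    push_cast
    have : ((n : ℝ) + 1) ≠ 0 := by positivity
    field_simp
    ring
  have h1 : ∑' n : ℕ, ENNReal.ofReal (Real.exp (-r) * r ^ n / n.factorial) = 1 := by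
    rw [← ENNReal.ofReal_tsum_of_nonneg (fun n => by positivity)
      (hasSum_one_poissonMeasure r).summable, (hasSum_one_poissonMeasure r).tsum_eq,
      ENNReal.ofReal_one]
  rw [poissonMeasure, lintegral_sum_measure]
  simp only [lintegral_smul_measure, lintegral_dirac, smul_eq_mul]
  rw [tsum_eq_zero_add' ENNReal.summable]
  simp_rw [h0]
  rw [ENNReal.tsum_mul_left, h1]
  simp

variable {Ω : Type*} [MeasurableSpace Ω] {P : Measure Ω} {ξ : ℕ → Ω → ℝ} {μ : Measure ℝ}

/-- The sum of the laws of the points of a Poisson process is at most its intensity measure (in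
fact it is equal to it, but only this bound is needed, and it is trivial on sets of infinite
intensity). -/
lemma IsPoissonProcess.sum_map_le (hξ : IsPoissonProcess ξ μ P) :
    Measure.sum (fun j => P.map (ξ j)) ≤ μ := by
  refine Measure.le_iff.2 fun A hA => ?_
  by_cases hfin : μ A = ⊤
  · simp [hfin]
  have hlaw := hξ.hasLaw A hA (lt_top_iff_ne_top.2 hfin)
  have h1 := hlaw.lintegral_comp (f := fun x => x) (by fun_prop)
  rw [lintegral_map (by fun_prop) (by fun_prop), lintegral_natCast_poissonMeasure,
    ENNReal.coe_toNNReal hfin] at h1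
  rw [← h1, Measure.sum_apply _ hA]
  have h (ω : Ω) : pointProcess ξ ω A = ∑' j, A.indicator 1 (ξ j ω) := by
    simp [pointProcess, hA]
  simp_rw [h]
  have hm (j : ℕ) : AEMeasurable (fun ω => A.indicator (1 : ℝ → ℝ≥0∞) (ξ j ω)) P :=
    ((measurable_one.indicator hA).comp (hξ.measurable j)).aemeasurable
  rw [lintegral_tsum hm]
  refine (tsum_congr fun j => ?_).le
  rw [← lintegral_map (measurable_one.indicator hA) (hξ.measurable j), lintegral_indicator_one hA]

section Marked

variable {E : Type*} [MeasurableSpace E] {W : ℕ → Ω → E} {ν : Measure E}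
  {C : Set (ℝ × E)}

/-- If the points of a Poisson process with intensity `μ` carry independent marks with law `ν`,
then no marked point falls into `C` with probability `exp (-(μ ⊗ ν) C)`: conditionally on the
points this probability is the product of the numbers `1 - ν C_{ξⱼ}`, where `C_u` is the section of
`C` at `u`, and its mean is a value of the Laplace functional. -/
theorem IsPoissonProcess.measure_forall_marked_notMem [IsProbabilityMeasure P] [SigmaFinite μ]
    [IsProbabilityMeasure ν] (hξ : IsPoissonProcess ξ μ P) (hW : ∀ j, Measurable (W j))
    (hlaw : ∀ j, P.map (W j) = ν) (hind : iIndepFun W P)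
    (hξW : IndepFun (fun ω j => ξ j ω) (fun ω j => W j ω) P) (hC : MeasurableSet C) :
    P {ω | ∀ j, (ξ j ω, W j ω) ∉ C} = expNeg ((μ.prod ν) C) := by
  have hξm : Measurable fun ω j => ξ j ω := measurable_pi_lambda _ hξ.measurable
  have hWm : Measurable fun ω j => W j ω := measurable_pi_lambda _ hW
  have hWlaw : P.map (fun ω j => W j ω) = Measure.infinitePi fun _ => ν := by
    rw [hind.map_fun_eq_infinitePi_map hW]
    simp_rw [hlaw]
  have hjoint : P.map (fun ω => ((fun j => ξ j ω), (fun j => W j ω))) =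
      (P.map fun ω j => ξ j ω).prod (Measure.infinitePi fun _ => ν) := by
    rw [← hWlaw]
    exact (indepFun_iff_map_prod_eq_prod_map_map hξm.aemeasurable hWm.aemeasurable).1 hξW
  set D : Set ((ℕ → ℝ) × (ℕ → E)) := {p | ∀ j, (p.1 j, p.2 j) ∉ C} with hD
  have hDm : MeasurableSet D := by
    have : D = ⋂ j, (fun p : (ℕ → ℝ) × (ℕ → E) => (p.1 j, p.2 j)) ⁻¹' Cᶜ := by
      ext p; simp [hD]
    rw [this]
    exact MeasurableSet.iInter fun j => (by fun_prop : Measurable _) hC.compl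
  have hsec (u : ℝ) : MeasurableSet (Prod.mk u ⁻¹' C) := measurable_prodMk_left hC
  have hνm : Measurable fun u => ν (Prod.mk u ⁻¹' C) := measurable_measure_prodMk_left hC
  -- `f` is chosen so that `e^{-f u} = 1 - ν C_u`; it is infinite where `C_u` has full measure.
  set f : ℝ → ℝ≥0∞ := fun u => (-ENNReal.log (1 - ν (Prod.mk u ⁻¹' C))).toENNReal with hf
  have hfm : Measurable f :=
    ((measurable_const.sub hνm).ennreal_log.neg).ereal_toENNReal
  have hfexp (u : ℝ) : expNeg (f u) = 1 - ν (Prod.mk u ⁻¹' C) :=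
    expNeg_toENNReal_neg_log tsub_le_self
  have h1 : P {ω | ∀ j, (ξ j ω, W j ω) ∉ C} =
      (P.map (fun ω => ((fun j => ξ j ω), (fun j => W j ω)))) D := by
    rw [Measure.map_apply (hξm.prodMk hWm) hDm]
    rfl
  have hslice (u : ℕ → ℝ) : (Measure.infinitePi fun _ : ℕ => ν) (Prod.mk u ⁻¹' D) =
      expNeg (∑' j, f (u j)) := by
    have : Prod.mk u ⁻¹' D = Set.univ.pi fun j => (Prod.mk (u j) ⁻¹' C)ᶜ := by
      ext w; simp [hD]
    rw [this, Measure.infinitePi_pi_univ _ fun j => (hsec _).compl, expNeg_tsum]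
    refine tprod_congr fun j => ?_
    rw [hfexp, prob_compl_eq_one_sub (hsec _)]
  have hmeas : Measurable fun u : ℕ → ℝ => expNeg (∑' j, f (u j)) :=
    measurable_expNeg.comp (Measurable.tsum fun j => hfm.comp (measurable_pi_apply j))
  rw [h1, hjoint, Measure.prod_apply hDm]
  simp_rw [hslice]
  rw [lintegral_map hmeas hξm]
  simp_rw [← lintegral_pointProcess _ hfm]
  rw [hξ.laplace hfm, Measure.prod_apply hC]
  congr 1
  refine lintegral_congr fun u => ?_
  rw [hfexp, ENNReal.sub_sub_cancel ENNReal.one_ne_top prob_le_one]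

/-- Almost surely only finitely many marked points fall into a set of finite intensity, because the
expected number of these points is finite. -/
theorem IsPoissonProcess.ae_finite_marked_mem [IsProbabilityMeasure P]
    [IsProbabilityMeasure ν] (hξ : IsPoissonProcess ξ μ P) (hW : ∀ j, Measurable (W j))
    (hlaw : ∀ j, P.map (W j) = ν) (hξW : ∀ j, IndepFun (ξ j) (W j) P)
    (hC : MeasurableSet C) [SFinite μ] (hfin : (μ.prod ν) C ≠ ⊤) :
    ∀ᵐ ω ∂P, {j | (ξ j ω, W j ω) ∈ C}.Finite := by
  have hνm : Measurable fun u => ν (Prod.mk u ⁻¹' C) := measurable_measure_prodMk_left hC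
  have h (j : ℕ) : P {ω | (ξ j ω, W j ω) ∈ C} = ∫⁻ u, ν (Prod.mk u ⁻¹' C) ∂(P.map (ξ j)) := by
    have hprod := (indepFun_iff_map_prod_eq_prod_map_map (hξ.measurable j).aemeasurable
      (hW j).aemeasurable).1 (hξW j)
    rw [hlaw] at hprod
    rw [← Measure.prod_apply hC, ← hprod,
      Measure.map_apply ((hξ.measurable j).prodMk (hW j)) hC]
    rfl
  have hsum : ∑' j, P {ω | (ξ j ω, W j ω) ∈ C} ≠ ⊤ := by
    simp_rw [h]
    rw [← lintegral_sum_measure]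
    refine ne_top_of_le_ne_top hfin ?_
    rw [Measure.prod_apply hC]
    exact lintegral_mono' hξ.sum_map_le le_rfl
  exact ae_finite_setOfPred_mem hsum

end Marked

/-- A real sequence with finitely many terms above every level attains its supremum. -/
lemma isGreatest_iSup_of_finite {a : ℕ → ℝ} (h : ∀ K : ℕ, {j | -(K : ℝ) < a j}.Finite) :
    IsGreatest (Set.range a) (⨆ j, a j) := by
  -- A level below `a 0` leaves a finite nonempty set of indices in which to look for the maximum.
  obtain ⟨K, hK⟩ := exists_nat_gt (-a 0)
  have h0 : 0 ∈ (h K).toFinset := by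
    simp; linarith
  obtain ⟨m, hm, hmax⟩ := (h K).toFinset.exists_max_image a ⟨0, h0⟩
  have hle (j : ℕ) : a j ≤ a m := by
    by_cases hj : -(K : ℝ) < a j
    · exact hmax j (by simpa using hj)
    · exact (not_lt.1 hj).trans (by simpa using ((Set.Finite.mem_toFinset _).1 hm).le)
  have hg : IsGreatest (Set.range a) (a m) := ⟨⟨m, rfl⟩, by rintro _ ⟨j, rfl⟩; exact hle j⟩
  rwa [show ⨆ j, a j = a m from hg.isLUB.csSup_eq ⟨a m, m, rfl⟩]

instance : SigmaFinite expIntensity := by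
  unfold expIntensity
  exact SigmaFinite.withDensity_ofReal _

lemma expIntensity_Ioi (a : ℝ) : expIntensity (Set.Ioi a) = ENNReal.ofReal (Real.exp (-a)) := by
  rw [expIntensity, withDensity_apply _ measurableSet_Ioi,
    ← ofReal_integral_eq_lintegral_ofReal (integrableOn_exp_neg_Ioi a)
      (ae_of_all _ fun x => (Real.exp_pos _).le), integral_exp_neg_Ioi]

/-- The intensity `e^{-u} du` turns into `y^{-2} dy` under `y = e^u`, so the points `e^u w` with
`w` distributed according to `ν` exceed `1` with total intensity `∫ w⁺ ν(dw)`. -/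
lemma expIntensity_prod_one_lt (ν : Measure ℝ) [SFinite ν] :
    (expIntensity.prod ν) {p | 1 < Real.exp p.1 * p.2} = ∫⁻ w, ENNReal.ofReal w ∂ν := by
  have hm : MeasurableSet {p : ℝ × ℝ | 1 < Real.exp p.1 * p.2} :=
    measurableSet_lt (by fun_prop) (by fun_prop)
  rw [Measure.prod_apply_symm hm]
  refine lintegral_congr fun w => ?_
  rcases le_or_gt w 0 with hw | hw
  · have : (fun u => (u, w)) ⁻¹' {p : ℝ × ℝ | 1 < Real.exp p.1 * p.2} = ∅ := by
      ext u
      simp only [Set.mem_preimage, Set.mem_ofPred_eq, Set.mem_empty_iff_false, iff_false, not_lt]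
      exact (mul_nonpos_of_nonneg_of_nonpos (Real.exp_pos u).le hw).trans zero_le_one
    rw [this, measure_empty, ENNReal.ofReal_of_nonpos hw]
  · have : (fun u => (u, w)) ⁻¹' {p : ℝ × ℝ | 1 < Real.exp p.1 * p.2} =
        Set.Ioi (-Real.log w) := by
      ext u
      simp only [Set.mem_preimage, Set.mem_ofPred_eq, Set.mem_Ioi]
      rw [← Real.log_pos_iff (by positivity), Real.log_mul (Real.exp_pos u).ne' hw.ne',
        Real.log_exp]
      constructor <;> intro h <;> linarith
    rw [this, expIntensity_Ioi, neg_neg, Real.exp_log hw]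

end

/-! ### Finite-dimensional Gaussian laws -/

open scoped RealInnerProductSpace Matrix MatrixOrder

section GaussianField

variable {T Ω : Type*} [MeasurableSpace Ω] {P : Measure Ω}
  {Y : T → Ω → ℝ} {n : ℕ}

lemma IsCenteredGaussianField.memLp_two (hY : IsCenteredGaussianField Y P) (s : T) :
    MemLp (Y s) 2 P :=
  (hY.isGaussian.hasGaussianLaw_eval s).memLp_two

lemma posSemidef_covMatrix [IsProbabilityMeasure P] (hY : IsCenteredGaussianField Y P)
    (t : Fin n → T) : (covMatrix Y P t).PosSemidef := by
  refine Matrix.PosSemidef.of_dotProduct_mulVec_nonneg ?_ fun x => ?_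
  · ext i j
    simp [covMatrix, covariance_comm (Y (t j))]
  · have hm (i : Fin n) : MemLp (fun ω => x i * Y (t i) ω) 2 P :=
      (hY.memLp_two (t i)).const_mul _
    have h := covariance_fun_sum_fun_sum hm hm
    simp_rw [covariance_const_mul_left, covariance_const_mul_right] at h
    have h0 : star x ⬝ᵥ covMatrix Y P t *ᵥ x = Var[fun ω => ∑ i, x i * Y (t i) ω; P] := by
      rw [← covariance_self (Finset.measurable_fun_sum _ fun i _ =>
        (hY.measurable (t i)).const_mul _).aemeasurable, h]
      simp only [dotProduct, Matrix.mulVec, covMatrix, Matrix.of_apply, star_trivial,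
        Finset.mul_sum]
      refine Finset.sum_congr rfl fun i _ => Finset.sum_congr rfl fun j _ => ?_
      ring
    rw [h0]
    exact variance_nonneg _ _

lemma IsCenteredGaussianField.hasGaussianLaw_toLp (hY : IsCenteredGaussianField Y P)
    (t : Fin n → T) : HasGaussianLaw (fun ω => WithLp.toLp 2 fun i => Y (t i) ω) P := by
  have h := (hY.isGaussian.comp_right t).hasGaussianLaw Finset.univ
  let L : (↥(Finset.univ : Finset (Fin n)) → ℝ) →L[ℝ] (Fin n → ℝ) :=
    ContinuousLinearMap.pi fun i => ContinuousLinearMap.proj ⟨i, Finset.mem_univ i⟩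
  exact (h.map_fun L).toLp_pi 2

/-- The finite-dimensional distributions of a centered Gaussian field are the laws `N(0, S)`. -/
lemma map_eq_multivariateGaussian [IsProbabilityMeasure P]
    (hY : IsCenteredGaussianField Y P) (t : Fin n → T) :
    P.map (fun ω => WithLp.toLp 2 fun i => Y (t i) ω) =
      multivariateGaussian 0 (covMatrix Y P t) := by
  have hS := posSemidef_covMatrix hY t
  have hG := hY.hasGaussianLaw_toLp t
  have hm : Measurable fun ω => WithLp.toLp 2 fun i => Y (t i) ω :=
    (WithLp.measurable_toLp 2 _).comp (measurable_pi_lambda _ fun i => hY.measurable (t i))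
  have := hG.isGaussian_map
  have hid : MemLp id 2 (P.map fun ω => WithLp.toLp 2 fun i => Y (t i) ω) := IsGaussian.memLp_two_id
  apply IsGaussian.ext
  · rw [integral_id_multivariateGaussian', integral_map hm.aemeasurable (by fun_prop)]
    ext i
    have h := (EuclideanSpace.proj (𝕜 := ℝ) i).integral_comp_comm hG.integrable
    simp only [EuclideanSpace.coe_proj, id_eq] at h ⊢
    rw [← h]
    simpa using hY.centered (t i)
  · rw [← ContinuousLinearMap.toBilinForm_inj]
    refine LinearMap.BilinForm.ext_basis (EuclideanSpace.basisFun (Fin n) ℝ).toBasis fun i j => ?_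
    rw [ContinuousLinearMap.toBilinForm_apply, ContinuousLinearMap.toBilinForm_apply,
      covarianceBilin_apply_eq_cov hid, covarianceBilin_multivariateGaussian hS,
      covariance_map (by fun_prop) (by fun_prop) hm.aemeasurable]
    have (i : Fin n) : (fun u => ⟪(EuclideanSpace.basisFun (Fin n) ℝ).toBasis i, u⟫) ∘
        (fun ω => WithLp.toLp 2 fun i => Y (t i) ω) = Y (t i) := by
      ext; simp [PiLp.inner_apply]
    rw [this, this]
    simp [covMatrix]

end GaussianField

section Density

variable {n : ℕ}

/-- The product of standard Gaussian laws has as density the product of the densities. -/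
lemma pi_gaussianReal_eq_withDensity :
    Measure.pi (fun _ : Fin n => gaussianReal 0 1) =
      volume.withDensity fun x => ENNReal.ofReal (∏ i, gaussianPDFReal 0 1 (x i)) := by
  refine Measure.pi_eq fun s hs => ?_
  have hint (i : Fin n) : Integrable (gaussianPDFReal 0 1) (volume.restrict (s i)) :=
    (integrable_gaussianPDFReal 0 1).restrict
  rw [withDensity_apply _ (MeasurableSet.univ_pi hs), volume_pi, Measure.restrict_pi_pi,
    ← ofReal_integral_eq_lintegral_ofReal (Integrable.fintype_prod hint)
      (ae_of_all _ fun x => Finset.prod_nonneg fun i _ => gaussianPDFReal_nonneg _ _ _),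
    integral_fintype_prod_eq_prod (fun _ => gaussianPDFReal 0 1),
    ENNReal.ofReal_prod_of_nonneg fun i _ =>
      integral_nonneg fun x => gaussianPDFReal_nonneg _ _ _]
  refine Finset.prod_congr rfl fun i _ => ?_
  rw [gaussianReal_apply_eq_integral _ one_ne_zero]

lemma gaussianDensity_nonneg {S : Matrix (Fin n) (Fin n) ℝ} (hS : 0 ≤ S.det) (z : Fin n → ℝ) :
    0 ≤ gaussianDensity S z := by
  unfold gaussianDensity
  positivity

lemma continuous_gaussianDensity (S : Matrix (Fin n) (Fin n) ℝ) :
    Continuous (gaussianDensity S) := by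
  unfold gaussianDensity
  simp only [dotProduct, Matrix.mulVec]
  fun_prop

/-- The substitution `z = A x` turns the density of `N(0, A²)` into the standard Gaussian one. -/
lemma prod_gaussianPDFReal_eq {A : Matrix (Fin n) (Fin n) ℝ} (hA : A.IsSymm)
    (hdet : A.det ≠ 0) (x : Fin n → ℝ) :
    ∏ i, gaussianPDFReal 0 1 (x i) = |A.det| * gaussianDensity (A * A) (A *ᵥ x) := by
  have hu : IsUnit A.det := hdet.isUnit
  have h1 : (A *ᵥ x) ⬝ᵥ ((A * A)⁻¹ *ᵥ (A *ᵥ x)) = ∑ i, x i ^ 2 := by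
    rw [Matrix.mul_inv_rev, Matrix.mulVec_mulVec, Matrix.mul_assoc, Matrix.nonsing_inv_mul _ hu,
      Matrix.mul_one, ← Matrix.vecMul_transpose, hA.eq, ← Matrix.dotProduct_mulVec,
      Matrix.mulVec_mulVec, Matrix.mul_nonsing_inv _ hu, Matrix.one_mulVec]
    simp [dotProduct, sq]
  have h2 : (A * A).det ^ (-(1 / 2) : ℝ) = |A.det|⁻¹ := by
    rw [Matrix.det_mul, Real.rpow_neg (mul_self_nonneg _), ← Real.sqrt_eq_rpow,
      Real.sqrt_mul_self_eq_abs]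
  have h3 : (2 * Real.pi) ^ (-(n : ℝ) / 2) = ((√(2 * Real.pi))⁻¹) ^ n := by
    rw [Real.sqrt_eq_rpow, ← Real.rpow_neg (by positivity), ← Real.rpow_natCast,
      ← Real.rpow_mul (by positivity)]
    congr 1
    ring
  have h4 : |A.det| ≠ 0 := abs_ne_zero.2 hdet
  rw [gaussianDensity, h1, h2, h3]
  simp only [gaussianPDFReal, Finset.prod_mul_distrib, ← Real.exp_sum, Finset.prod_const,
    Finset.card_univ, Fintype.card_fin, NNReal.coe_one, mul_one, sub_zero]
  rw [Finset.mul_sum]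
  field_simp

/-- The law `N(0, S)` has density `f_S` if `S` is positive definite. -/
lemma map_ofLp_multivariateGaussian {S : Matrix (Fin n) (Fin n) ℝ} (hS : S.PosDef) :
    (multivariateGaussian 0 S).map WithLp.ofLp =
      volume.withDensity fun z => ENNReal.ofReal (gaussianDensity S z) := by
  set A := CFC.sqrt S with hAdef
  have hAA : A * A = S := CFC.sqrt_mul_sqrt_self _ hS.posSemidef.nonneg
  have hAs : A.IsSymm := by
    have h : Aᴴ = A := (CFC.sqrt_nonneg S).isSelfAdjoint
    rwa [Matrix.conjTranspose_eq_transpose_of_trivial] at h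
  have hdet : A.det ≠ 0 := fun h => hS.det_pos.ne' (by rw [← hAA, Matrix.det_mul, h, zero_mul])
  have hAm : Measurable fun x : Fin n → ℝ => A *ᵥ x :=
    (Continuous.matrix_mulVec continuous_const continuous_id).measurable
  have h1 : (multivariateGaussian 0 S).map WithLp.ofLp =
      (Measure.pi fun _ : Fin n => gaussianReal 0 1).map fun x => A *ᵥ x := by
    rw [multivariateGaussian, ← map_pi_eq_stdGaussian, Measure.map_map (by fun_prop) (by fun_prop),
      Measure.map_map (by fun_prop) (by fun_prop)]
    congr 1
    ext x i
    simp [← hAdef]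
  have hd : Measurable fun z => ENNReal.ofReal (gaussianDensity S z) :=
    (continuous_gaussianDensity S).measurable.ennreal_ofReal
  have h2 := Real.map_matrix_volume_pi_eq_smul_volume_pi hdet
  rw [h1, pi_gaussianReal_eq_withDensity]
  ext B hB
  rw [Measure.map_apply hAm hB, withDensity_apply _ (hAm hB), withDensity_apply _ hB]
  simp_rw [prod_gaussianPDFReal_eq hAs hdet, hAA, ENNReal.ofReal_mul (abs_nonneg _)]
  have hdA : Measurable fun a => ENNReal.ofReal (gaussianDensity S (A *ᵥ a)) := hd.comp hAm
  rw [lintegral_const_mul _ hdA]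
  have h3 := setLIntegral_map (μ := volume) hB hd hAm
  rw [← h3]
  have h4 : Measure.map (fun x => A *ᵥ x) (volume : Measure (Fin n → ℝ)) =
      ENNReal.ofReal |A.det⁻¹| • volume := h2
  rw [h4, Measure.restrict_smul, lintegral_smul_measure, smul_eq_mul, ← mul_assoc,
    ← ENNReal.ofReal_mul (abs_nonneg _), ← abs_mul, mul_inv_cancel₀ hdet]
  simp

end Density

/-! ### The tail dependence function -/

section MaxExp

variable {n : ℕ} {x c : Fin n → ℝ}

/-- The function `z ↦ maxᵢ xᵢ e^{zᵢ - cᵢ}`; it is `0` if `n = 0`. -/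
def maxExp (x c z : Fin n → ℝ) : ℝ := ⨆ i, x i * Real.exp (z i - c i)

lemma measurable_maxExp (x c : Fin n → ℝ) : Measurable (maxExp x c) :=
  Measurable.iSup fun i => by fun_prop

lemma maxExp_nonneg (hx : ∀ i, 0 ≤ x i) (z : Fin n → ℝ) : 0 ≤ maxExp x c z :=
  Real.iSup_nonneg fun i => mul_nonneg (hx i) (Real.exp_pos _).le

lemma maxExp_le_iff {y : ℝ} (hy : 0 ≤ y) (z : Fin n → ℝ) :
    maxExp x c z ≤ y ↔ ∀ i, x i * Real.exp (z i - c i) ≤ y :=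
  ⟨fun h i => (le_ciSup (f := fun i => x i * Real.exp (z i - c i))
    (Set.finite_range _).bddAbove i).trans h, fun h => Real.iSup_le h hy⟩

lemma integrable_exp_apply_multivariateGaussian {S : Matrix (Fin n) (Fin n) ℝ}
    (hS : S.PosSemidef) (i : Fin n) :
    Integrable (fun z : EuclideanSpace ℝ (Fin n) => Real.exp (z i)) (multivariateGaussian 0 S) := by
  have h := (measurePreserving_eval_multivariateGaussian (μ := 0) hS (i := i)).integrable_comp
    (g := Real.exp) (by fun_prop)
  refine h.2 ?_
  simpa using integrable_exp_mul_gaussianReal (μ := (0 : EuclideanSpace ℝ (Fin n)) i)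
    (v := (S i i).toNNReal) 1

lemma integrable_maxExp {S : Matrix (Fin n) (Fin n) ℝ} (hS : S.PosSemidef) (hx : ∀ i, 0 ≤ x i) :
    Integrable (fun z : EuclideanSpace ℝ (Fin n) => maxExp x c z) (multivariateGaussian 0 S) := by
  have hs : Integrable (fun z : EuclideanSpace ℝ (Fin n) => ∑ i, x i * Real.exp (z i - c i))
      (multivariateGaussian 0 S) := by
    refine integrable_finsetSum _ fun i _ => Integrable.const_mul ?_ _
    simp_rw [Real.exp_sub]
    exact (integrable_exp_apply_multivariateGaussian hS i).div_const _
  refine hs.mono' ((measurable_maxExp x c).comp (by fun_prop)).aestronglyMeasurable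
    (ae_of_all _ fun z => ?_)
  have h0 (i : Fin n) : 0 ≤ x i * Real.exp (z i - c i) := mul_nonneg (hx i) (Real.exp_pos _).le
  rw [Real.norm_of_nonneg (maxExp_nonneg hx _),
    maxExp_le_iff (Finset.sum_nonneg fun i _ => h0 i)]
  exact fun i => Finset.single_le_sum (fun i _ => h0 i) (Finset.mem_univ i)

end MaxExp

section BrownResnickField

variable {T Ω₀ Ω : Type*} [MeasurableSpace Ω₀] [MeasurableSpace Ω]
  {P₀ : Measure Ω₀} [IsProbabilityMeasure P₀] {P : Measure Ω}
  {Y₀ : T → Ω₀ → ℝ} {Y : ℕ → T → Ω → ℝ} {ξ : ℕ → Ω → ℝ} {n : ℕ} {x c : Fin n → ℝ}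

/-- The marks `maxᵢ xᵢ e^{Y^{(j)}(tᵢ) - cᵢ}` are distributed as `maxᵢ xᵢ e^{zᵢ - cᵢ}` under
`N(0, S)`. -/
lemma map_maxExp_eq (hY₀ : IsCenteredGaussianField Y₀ P₀)
    (hYcopy : ∀ j, IdentDistrib (fun ω s => Y j s ω) (fun ω s => Y₀ s ω) P P₀)
    (t : Fin n → T) (j : ℕ) :
    P.map (fun ω => maxExp x c fun i => Y j (t i) ω) =
      (multivariateGaussian 0 (covMatrix Y₀ P₀ t)).map
        fun z : EuclideanSpace ℝ (Fin n) => maxExp x c z := by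
  have hm : Measurable fun u : T → ℝ => maxExp x c fun i => u (t i) :=
    (measurable_maxExp x c).comp (measurable_pi_lambda _ fun i => measurable_pi_apply _)
  have hm' : Measurable fun z : EuclideanSpace ℝ (Fin n) => maxExp x c z :=
    (measurable_maxExp x c).comp (by fun_prop)
  have hvec : Measurable fun ω => WithLp.toLp 2 fun i => Y₀ (t i) ω :=
    (WithLp.measurable_toLp 2 _).comp (measurable_pi_lambda _ fun i => hY₀.measurable (t i))
  rw [← map_eq_multivariateGaussian hY₀, Measure.map_map hm' hvec]
  exact ((hYcopy j).comp hm).map_eq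

lemma indepFun_maxExp (hξY : IndepFun (fun ω j => ξ j ω) (fun ω j s => Y j s ω) P)
    (t : Fin n → T) :
    IndepFun (fun ω j => ξ j ω) (fun ω j => maxExp x c fun i => Y j (t i) ω) P := by
  have hm : Measurable fun (u : ℕ → T → ℝ) (j : ℕ) => maxExp x c fun i => u j (t i) :=
    measurable_pi_lambda _ fun j => (measurable_maxExp x c).comp
      (measurable_pi_lambda _ fun i => (measurable_pi_apply _).comp (measurable_pi_apply _))
  exact hξY.comp measurable_id hm

variable [IsProbabilityMeasure P]

/-- The marked points exceed the level `1` with total intensity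
`∫ maxᵢ xᵢ e^{zᵢ - cᵢ} N(0, S)(dz)`. -/
lemma expIntensity_prod_map_maxExp {S : Matrix (Fin n) (Fin n) ℝ} (hS : S.PosSemidef)
    (hx : ∀ i, 0 ≤ x i) :
    (expIntensity.prod ((multivariateGaussian 0 S).map
      fun z : EuclideanSpace ℝ (Fin n) => maxExp x c z)) {p | 1 < Real.exp p.1 * p.2} =
      ENNReal.ofReal
        (∫ z : EuclideanSpace ℝ (Fin n), maxExp x c z ∂(multivariateGaussian 0 S)) := by
  have hm' : Measurable fun z : EuclideanSpace ℝ (Fin n) => maxExp x c z :=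
    (measurable_maxExp x c).comp (by fun_prop)
  rw [expIntensity_prod_one_lt, lintegral_map (by fun_prop) hm',
    ofReal_integral_eq_lintegral_ofReal (integrable_maxExp hS hx)
      (ae_of_all _ fun z => maxExp_nonneg hx _)]

lemma measurableSet_one_lt_exp_mul : MeasurableSet {p : ℝ × ℝ | 1 < Real.exp p.1 * p.2} :=
  measurableSet_lt (by fun_prop) (by fun_prop)

/-- The probability that no marked point `(ξ_j, W_j)` satisfies `1 < e^{ξ_j} W_j`, where
`W_j = maxᵢ xᵢ e^{Y^{(j)}(tᵢ) - cᵢ}`. -/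
lemma measure_forall_exp_mul_maxExp_le (hY₀ : IsCenteredGaussianField Y₀ P₀)
    (hYmeas : ∀ j s, Measurable (Y j s))
    (hYcopy : ∀ j, IdentDistrib (fun ω s => Y j s ω) (fun ω s => Y₀ s ω) P P₀)
    (hYindep : iIndepFun (fun j ω s => Y j s ω) P)
    (hξ : IsPoissonProcess ξ expIntensity P)
    (hξY : IndepFun (fun ω j => ξ j ω) (fun ω j s => Y j s ω) P)
    (t : Fin n → T) (hx : ∀ i, 0 ≤ x i) :
    P {ω | ∀ j, Real.exp (ξ j ω) * maxExp x c (fun i => Y j (t i) ω) ≤ 1} =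
      ENNReal.ofReal (Real.exp (-∫ z : EuclideanSpace ℝ (Fin n), maxExp x c z
        ∂(multivariateGaussian 0 (covMatrix Y₀ P₀ t)))) := by
  have hm' : Measurable fun z : EuclideanSpace ℝ (Fin n) => maxExp x c z :=
    (measurable_maxExp x c).comp (by fun_prop)
  have hm : Measurable fun u : T → ℝ => maxExp x c fun i => u (t i) :=
    (measurable_maxExp x c).comp (measurable_pi_lambda _ fun i => measurable_pi_apply _)
  have := Measure.isProbabilityMeasure_map (μ := multivariateGaussian 0 (covMatrix Y₀ P₀ t))
    hm'.aemeasurable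
  have key := hξ.measure_forall_marked_notMem
    (W := fun j ω => maxExp x c fun i => Y j (t i) ω)
    (fun j => (measurable_maxExp x c).comp (measurable_pi_lambda _ fun i => hYmeas j (t i)))
    (map_maxExp_eq hY₀ hYcopy t) (hYindep.comp _ fun _ => hm) (indepFun_maxExp hξY t)
    measurableSet_one_lt_exp_mul
  rw [expIntensity_prod_map_maxExp (posSemidef_covMatrix hY₀ t) hx,
    expNeg_ofReal (integral_nonneg fun z => maxExp_nonneg hx _)] at key
  rw [← key]
  simp

lemma ae_finite_one_lt_exp_mul_maxExp (hY₀ : IsCenteredGaussianField Y₀ P₀)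
    (hYmeas : ∀ j s, Measurable (Y j s))
    (hYcopy : ∀ j, IdentDistrib (fun ω s => Y j s ω) (fun ω s => Y₀ s ω) P P₀)
    (hξ : IsPoissonProcess ξ expIntensity P)
    (hξY : IndepFun (fun ω j => ξ j ω) (fun ω j s => Y j s ω) P)
    (t : Fin n → T) (hx : ∀ i, 0 ≤ x i) :
    ∀ᵐ ω ∂P, {j | 1 < Real.exp (ξ j ω) * maxExp x c (fun i => Y j (t i) ω)}.Finite := by
  have hm' : Measurable fun z : EuclideanSpace ℝ (Fin n) => maxExp x c z :=
    (measurable_maxExp x c).comp (by fun_prop)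
  have := Measure.isProbabilityMeasure_map (μ := multivariateGaussian 0 (covMatrix Y₀ P₀ t))
    hm'.aemeasurable
  refine hξ.ae_finite_marked_mem
    (W := fun j ω => maxExp x c fun i => Y j (t i) ω)
    (fun j => (measurable_maxExp x c).comp (measurable_pi_lambda _ fun i => hYmeas j (t i)))
    (map_maxExp_eq hY₀ hYcopy t)
    (fun j => (indepFun_maxExp hξY t).comp (measurable_pi_apply j) (measurable_pi_apply j))
    measurableSet_one_lt_exp_mul ?_
  rw [expIntensity_prod_map_maxExp (posSemidef_covMatrix hY₀ t) hx]
  exact ENNReal.ofReal_ne_top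

/-- The maximum that defines the Brown–Resnick field is almost surely attained. -/
theorem ae_isGreatest_gumbelField (hY₀ : IsCenteredGaussianField Y₀ P₀)
    (hYmeas : ∀ j s, Measurable (Y j s))
    (hYcopy : ∀ j, IdentDistrib (fun ω s => Y j s ω) (fun ω s => Y₀ s ω) P P₀)
    (hξ : IsPoissonProcess ξ expIntensity P)
    (hξY : IndepFun (fun ω j => ξ j ω) (fun ω j s => Y j s ω) P) (v : T → ℝ) (s : T) :
    ∀ᵐ ω ∂P, IsGreatest (Set.range fun j => ξ j ω + Y j s ω - v s / 2)
      (gumbelField ξ Y v s ω) := by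
  -- A single site with the weight `e^K` counts the indices whose value exceeds `-K`.
  have h (K : ℕ) := ae_finite_one_lt_exp_mul_maxExp hY₀ hYmeas hYcopy hξ hξY
    (x := fun _ : Fin 1 => Real.exp K) (c := fun _ => v s / 2) (fun _ => s)
    fun _ => (Real.exp_pos _).le
  filter_upwards [ae_all_iff.2 h] with ω hω
  refine isGreatest_iSup_of_finite fun K => (hω K).subset fun j hj => ?_
  simp only [Set.mem_ofPred_eq, maxExp, ciSup_const, ← Real.exp_add, Real.one_lt_exp_iff] at hj ⊢
  linarith

/-- The argument `a⁻¹` of the distribution function, read as `∞` if `a = 0`. -/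
lemma coe_le_inv_ofReal_iff {a b : ℝ} (hb : 0 < b) :
    (b : EReal) ≤ (((ENNReal.ofReal a ^ (1 / (1 : ℝ)))⁻¹ : ℝ≥0∞) : EReal) ↔ a * b ≤ 1 := by
  rw [← EReal.toReal_coe b, ← max_eq_left hb.le, EReal.toReal_coe, ← EReal.coe_ennreal_ofReal,
    EReal.coe_ennreal_le_coe_ennreal_iff, div_one, ENNReal.rpow_one, ENNReal.le_inv_iff_mul_le,
    ← ENNReal.ofReal_mul hb.le, ENNReal.ofReal_le_one, max_eq_left hb.le, mul_comm]

/-- The tail dependence function of the Brown–Resnick field is the mean of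
`maxᵢ xᵢ e^{zᵢ - σ²(tᵢ) / 2}` under `N(0, S)`. -/
theorem tailDependence_frechetField (hY₀ : IsCenteredGaussianField Y₀ P₀)
    (hYmeas : ∀ j s, Measurable (Y j s))
    (hYcopy : ∀ j, IdentDistrib (fun ω s => Y j s ω) (fun ω s => Y₀ s ω) P P₀)
    (hYindep : iIndepFun (fun j ω s => Y j s ω) P)
    (hξ : IsPoissonProcess ξ expIntensity P)
    (hξY : IndepFun (fun ω j => ξ j ω) (fun ω j s => Y j s ω) P)
    (v : T → ℝ) (t : Fin n → T) (hx : ∀ i, 0 ≤ x i) :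
    tailDependence 1 (fun i => frechetField ξ Y v (t i)) P x =
      ∫ z : EuclideanSpace ℝ (Fin n), maxExp x (fun i => v (t i) / 2) z
        ∂(multivariateGaussian 0 (covMatrix Y₀ P₀ t)) := by
  have hatt : ∀ᵐ ω ∂P, ∀ i, IsGreatest (Set.range fun j => ξ j ω + Y j (t i) ω - v (t i) / 2)
      (gumbelField ξ Y v (t i) ω) :=
    ae_all_iff.2 fun i => ae_isGreatest_gumbelField hY₀ hYmeas hYcopy hξ hξY v (t i)
  -- The supremum in `gumbelField` is a maximum outside a null set, so no junk value interferes.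
  have hevent : {ω | ∀ i, (frechetField ξ Y v (t i) ω : EReal) ≤
        (((ENNReal.ofReal (x i) ^ (1 / (1 : ℝ)))⁻¹ : ℝ≥0∞) : EReal)} =ᵐ[P]
      {ω | ∀ j, Real.exp (ξ j ω) *
        maxExp x (fun i => v (t i) / 2) (fun i => Y j (t i) ω) ≤ 1} := by
    refine eventuallyEq_set.2 ?_
    filter_upwards [hatt] with ω hω
    have hi (i : Fin n) : (frechetField ξ Y v (t i) ω : EReal) ≤
        (((ENNReal.ofReal (x i) ^ (1 / (1 : ℝ)))⁻¹ : ℝ≥0∞) : EReal) ↔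
        ∀ j, x i * Real.exp (ξ j ω + Y j (t i) ω - v (t i) / 2) ≤ 1 := by
      rw [frechetField, coe_le_inv_ofReal_iff (Real.exp_pos _)]
      obtain ⟨⟨m, hm⟩, hub⟩ := hω i
      refine ⟨fun h j => le_trans ?_ h, fun h => ?_⟩
      · exact mul_le_mul_of_nonneg_left (Real.exp_le_exp.2 (hub ⟨j, rfl⟩)) (hx i)
      · rw [← hm]
        exact h m
    have hj (j : ℕ) : Real.exp (ξ j ω) *
        maxExp x (fun i => v (t i) / 2) (fun i => Y j (t i) ω) ≤ 1 ↔
        ∀ i, x i * Real.exp (ξ j ω + Y j (t i) ω - v (t i) / 2) ≤ 1 := by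
      rw [← le_div_iff₀' (Real.exp_pos _), maxExp_le_iff (by positivity)]
      refine forall_congr' fun i => ?_
      rw [le_div_iff₀' (Real.exp_pos _), add_sub_assoc, Real.exp_add, mul_left_comm]
    simp only [hi, hj]
    exact forall_comm
  rw [tailDependence, jointCDF, measureReal_def, measure_congr hevent,
    measure_forall_exp_mul_maxExp_le hY₀ hYmeas hYcopy hYindep hξ hξY t hx,
    ENNReal.toReal_ofReal (Real.exp_pos _).le, Real.log_exp, neg_neg]

end BrownResnickField

section Formulas

variable {n : ℕ} {x c : Fin n → ℝ} {S : Matrix (Fin n) (Fin n) ℝ}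

/-- The argument `log (y / a) + c` of the Gaussian distribution function, read as `∞` if `a = 0`. -/
lemma coe_le_log_div_add_iff {a y : ℝ} (ha : 0 ≤ a) (hy : 0 < y) (z c : ℝ) :
    (z : EReal) ≤ ENNReal.log (ENNReal.ofReal y / ENNReal.ofReal a) + (c : EReal) ↔
      a * Real.exp (z - c) ≤ y := by
  rcases ha.eq_or_lt with rfl | ha
  · have h : ENNReal.ofReal y / ENNReal.ofReal 0 = ⊤ := by
      rw [ENNReal.ofReal_zero]
      exact ENNReal.div_zero (by simpa using hy)
    simp only [h, ENNReal.log_top, EReal.top_add_coe, le_top, zero_mul, hy.le]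
  · rw [← ENNReal.ofReal_div_of_pos ha, ENNReal.log_ofReal_of_pos (by positivity),
      ← EReal.coe_add, EReal.coe_le_coe_iff, ← sub_le_iff_le_add,
      Real.le_log_iff_exp_le (by positivity), le_div_iff₀' ha]

lemma one_sub_gaussianCDF_eq (hx : ∀ i, 0 ≤ x i) {y : ℝ} (hy : 0 < y) :
    1 - gaussianCDF S (fun i =>
        ENNReal.log (ENNReal.ofReal y / ENNReal.ofReal (x i)) + ((c i : ℝ) : EReal)) =
      (multivariateGaussian 0 S).real {z | y < maxExp x c z} := by
  have hm' : Measurable fun z : EuclideanSpace ℝ (Fin n) => maxExp x c z :=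
    (measurable_maxExp x c).comp (by fun_prop)
  have h : {z : EuclideanSpace ℝ (Fin n) | y < maxExp x c z} = {z : EuclideanSpace ℝ (Fin n) |
      ∀ i, ((z i : ℝ) : EReal) ≤
        ENNReal.log (ENNReal.ofReal y / ENNReal.ofReal (x i)) + ((c i : ℝ) : EReal)}ᶜ := by
    ext z
    simp only [Set.mem_ofPred_eq, Set.mem_compl_iff, coe_le_log_div_add_iff (hx _) hy,
      ← maxExp_le_iff hy.le, not_le]
  have hms : MeasurableSet {z : EuclideanSpace ℝ (Fin n) | y < maxExp x c z} :=
    measurableSet_lt measurable_const hm'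
  rw [← compl_compl {z : EuclideanSpace ℝ (Fin n) | y < maxExp x c z},
    probReal_compl_eq_one_sub hms.compl, h, compl_compl]
  rfl

/-- The layer cake formula for the tail of `maxᵢ xᵢ e^{zᵢ - cᵢ}` under `N(0, S)`. -/
lemma integral_maxExp_eq_integral_one_sub_gaussianCDF (hS : S.PosSemidef) (hx : ∀ i, 0 ≤ x i) :
    IntegrableOn (fun y : ℝ => 1 - gaussianCDF S fun i =>
        ENNReal.log (ENNReal.ofReal y / ENNReal.ofReal (x i)) + ((c i : ℝ) : EReal))
        (Set.Ioi 0) ∧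
      ∫ z : EuclideanSpace ℝ (Fin n), maxExp x c z ∂(multivariateGaussian 0 S) =
        ∫ y in Set.Ioi (0 : ℝ), (1 - gaussianCDF S fun i =>
          ENNReal.log (ENNReal.ofReal y / ENNReal.ofReal (x i)) + ((c i : ℝ) : EReal)) := by
  have hint := integrable_maxExp (c := c) hS hx
  have hnn : 0 ≤ᵐ[multivariateGaussian 0 S] fun z : EuclideanSpace ℝ (Fin n) => maxExp x c z :=
    ae_of_all _ fun z => maxExp_nonneg hx _
  have hcongr : ∀ y ∈ Set.Ioi (0 : ℝ), 1 - gaussianCDF S (fun i =>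
        ENNReal.log (ENNReal.ofReal y / ENNReal.ofReal (x i)) + ((c i : ℝ) : EReal)) =
      (multivariateGaussian 0 S).real {z | y < maxExp x c z} :=
    fun y hy => one_sub_gaussianCDF_eq hx hy
  constructor
  · refine IntegrableOn.congr_fun ?_ (fun y hy => (hcongr y hy).symm) measurableSet_Ioi
    have hanti : Antitone fun y : ℝ => multivariateGaussian 0 S
        {z : EuclideanSpace ℝ (Fin n) | y < maxExp x c z} :=
      fun a b hab => measure_mono fun z (hz : b < _) => lt_of_le_of_lt hab hz
    refine integrable_toReal_of_lintegral_ne_top hanti.measurable.aemeasurable ?_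
    rw [← lintegral_eq_lintegral_meas_lt _ hnn hint.aemeasurable]
    exact hint.lintegral_lt_top.ne
  · rw [hint.integral_eq_integral_meas_lt hnn]
    exact (setIntegral_congr_fun measurableSet_Ioi hcongr).symm

lemma integrable_and_integral_maxExp_mul_gaussianDensity (hS : S.PosDef) (hx : ∀ i, 0 ≤ x i) :
    Integrable (fun z => maxExp x c z * gaussianDensity S z) ∧
      ∫ z : EuclideanSpace ℝ (Fin n), maxExp x c z ∂(multivariateGaussian 0 S) =
        ∫ z, maxExp x c z * gaussianDensity S z := by
  have hd : Measurable fun z => ENNReal.ofReal (gaussianDensity S z) :=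
    (continuous_gaussianDensity S).measurable.ennreal_ofReal
  have hofLp : Measurable (WithLp.ofLp : EuclideanSpace ℝ (Fin n) → Fin n → ℝ) := by fun_prop
  have hmap := map_ofLp_multivariateGaussian hS
  have hmul (z : Fin n → ℝ) : (ENNReal.ofReal (gaussianDensity S z)).toReal • maxExp x c z =
      maxExp x c z * gaussianDensity S z := by
    rw [ENNReal.toReal_ofReal (gaussianDensity_nonneg hS.det_pos.le z), smul_eq_mul, mul_comm]
  have hint : Integrable (maxExp x c) ((multivariateGaussian 0 S).map WithLp.ofLp) :=
    (integrable_map_measure (measurable_maxExp x c).aestronglyMeasurable hofLp.aemeasurable).2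
      (integrable_maxExp hS.posSemidef hx)
  constructor
  · rw [hmap, integrable_withDensity_iff_integrable_smul' hd (ae_of_all _ fun _ =>
      ENNReal.ofReal_lt_top)] at hint
    simpa only [hmul] using hint
  · rw [← integral_map hofLp.aemeasurable (measurable_maxExp x c).aestronglyMeasurable, hmap,
      integral_withDensity_eq_integral_toReal_smul hd (ae_of_all _ fun _ =>
        ENNReal.ofReal_lt_top)]
    simp only [hmul]

end Formulas

end BrownResnick

end

theorem mainTheorem9 {d : ℕ} {Ω₀ Ω : Type*} [MeasurableSpace Ω₀] [MeasurableSpace Ω]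
    (P₀ : Measure Ω₀) [IsProbabilityMeasure P₀] (P : Measure Ω) [IsProbabilityMeasure P]
    -- the underlying Gaussian field and its independent copies
    (Y₀ : EuclideanSpace ℝ (Fin d) → Ω₀ → ℝ)
    (hY₀ : BrownResnick.IsCenteredGaussianField Y₀ P₀)
    (hstat : BrownResnick.HasStationaryIncrements Y₀ P₀)
    (Y : ℕ → EuclideanSpace ℝ (Fin d) → Ω → ℝ)
    (hYmeas : ∀ j s, Measurable (Y j s))
    (hYcopy : ∀ j, IdentDistrib (fun ω s => Y j s ω) (fun ω s => Y₀ s ω) P P₀)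
    (hYindep : iIndepFun (fun j ω s => Y j s ω) P)
    -- the Poisson points, independent of the fields
    (ξ : ℕ → Ω → ℝ)
    (hξ : BrownResnick.IsPoissonProcess ξ BrownResnick.expIntensity P)
    (hξY : IndepFun (fun ω j => ξ j ω) (fun ω j s => Y j s ω) P)
    -- the variance function
    (v : EuclideanSpace ℝ (Fin d) → ℝ) (hv : ∀ s, v s = Var[Y₀ s; P₀])
    -- the sites, their covariance matrix, and the argument
    (n : ℕ) (t : Fin n → EuclideanSpace ℝ (Fin d))
    (S : Matrix (Fin n) (Fin n) ℝ) (hS : S = BrownResnick.covMatrix Y₀ P₀ t)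
    (x : Fin n → ℝ) (hx : ∀ i, 0 ≤ x i) :
    -- the maximum that defines the field is almost surely attained
    (∀ s, ∀ᵐ ω ∂P, IsGreatest (Set.range fun j => ξ j ω + Y j s ω - v s / 2)
      (BrownResnick.gumbelField ξ Y v s ω)) ∧
    -- first formula, against the law `N(0, S)`
    (Integrable (fun z : EuclideanSpace ℝ (Fin n) => ⨆ i, x i * Real.exp (z i - v (t i) / 2))
        (multivariateGaussian 0 S) ∧
      BrownResnick.tailDependence 1 (fun i => BrownResnick.frechetField ξ Y v (t i)) P x =
        ∫ z, ⨆ i, x i * Real.exp (z i - v (t i) / 2) ∂(multivariateGaussian 0 S)) ∧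
    -- first formula, against the density of `N(0, S)`
    (S.PosDef →
      Integrable (fun z : Fin n → ℝ =>
        (⨆ i, x i * Real.exp (z i - v (t i) / 2)) * BrownResnick.gaussianDensity S z) ∧
      BrownResnick.tailDependence 1 (fun i => BrownResnick.frechetField ξ Y v (t i)) P x =
        ∫ z : Fin n → ℝ,
          (⨆ i, x i * Real.exp (z i - v (t i) / 2)) * BrownResnick.gaussianDensity S z) ∧
    -- second formula
    (IntegrableOn (fun y : ℝ => 1 - BrownResnick.gaussianCDF S fun i =>
        ENNReal.log (ENNReal.ofReal y / ENNReal.ofReal (x i)) + ((v (t i) / 2 : ℝ) : EReal))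
        (Set.Ioi 0) ∧
      BrownResnick.tailDependence 1 (fun i => BrownResnick.frechetField ξ Y v (t i)) P x =
        ∫ y in Set.Ioi (0 : ℝ), (1 - BrownResnick.gaussianCDF S fun i =>
          ENNReal.log (ENNReal.ofReal y / ENNReal.ofReal (x i)) +
            ((v (t i) / 2 : ℝ) : EReal))) := by
  subst hS
  have hpsd := BrownResnick.posSemidef_covMatrix hY₀ t
  have htail := BrownResnick.tailDependence_frechetField hY₀ hYmeas hYcopy hYindep hξ hξY v t hx
  have hcdf := BrownResnick.integral_maxExp_eq_integral_one_sub_gaussianCDF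
    (c := fun i => v (t i) / 2) hpsd hx
  refine ⟨BrownResnick.ae_isGreatest_gumbelField hY₀ hYmeas hYcopy hξ hξY v,
    ⟨BrownResnick.integrable_maxExp hpsd hx, htail⟩, fun hpd => ?_, hcdf.1, htail.trans hcdf.2⟩
  have hden := BrownResnick.integrable_and_integral_maxExp_mul_gaussianDensity
    (c := fun i => v (t i) / 2) hpd hx
  exact ⟨hden.1, htail.trans hden.2⟩
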